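/- Let $T>0$, and let the background coefficient $\gamma_0$ on $\mathbb R^3$ be either $\gamma_0=I_3$ (homogeneous medium) or $\gamma_0(x)=\gamma_\pm I_3$ for $\pm x_3>0$ with constants $\gamma_\pm>0$, $\gamma_+\ne\gamma_-$ (two-layered medium). For a matrix-valued function $\gamma$ on $\mathbb R^3$ put $L_\gamma u=\operatorname{div}(\gamma\nabla u)$. For $f\in L^2(\mathbb R^3)$ (real-valued), a weak solution of $$(\partial_t^2-L_\gamma)u=0 \ \text{ in } (0,T)\times\mathbb R^3,\qquad u(0,\cdot)=0,\quad \partial_tu(0,\cdot)=f \tag{1}$$ is a function $u\in L^2(0,T;H^1(\mathbb R^3))$ with $\partial_tu\in L^2(0,T;L^2(\mathbb R^3))$ and $\partial_t^2u\in L^2(0,T;(H^1(\mathbb R^3))')$ such that, for a.e. $t\in(0,T)$, $\langle\partial_t^2u(t),\phi\rangle+\int_{\mathbb R^3}\gamma\nabla u(t)\cdot\nabla\phi\,dx=0$ for all $\phi\in H^1(\mathbb R^3)$, and such that the continuous representatives of $u$ in $C([0,T];L^2(\mathbb R^3))$ and of $\partial_tu$ in $C([0,T];(H^1(\mathbb R^3))')$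 take the values $0$ and $f$ at $t=0$. There exists a constant $C>0$, depending only on $T$ and $\gamma_0$, such that the following holds. Let $\gamma$ be a symmetric-matrix-valued function on $\mathbb R^3$ with entries in $L^\infty(\mathbb R^3)$ and $\gamma(x)\xi\cdot\xi\ge c_0|\xi|^2$ for all $\xi\in\mathbb R^3$ and a.e. $x$, for some $c_0>0$. Let $f\in L^2(\mathbb R^3)$, let $u$ be a weak solution of (1), and let $u_0$ be a weak solution of (1) with $\gamma$ replaced by $\gamma_0$. For $\tau\ge1$ let $v=v(\cdot;\tau)\in H^1(\mathbb R^3)$ be a weak solution of $(L_{\gamma_0}-\tau^2)v+f=0$ in $\mathbb R^3$, that is, $\int_{\mathbb R^3}(\gamma_0\nabla v\cdot\nabla\phi+\tau^2v\phi)\,dx=\int_{\mathbb R^3}f\phi\,dx$ for all $\phi\in H^1(\mathbb R^3)$, and put $$w(x;\tau)=\int_0^Te^{-\tau t}u(t,x)\,dt,\qquad \tilde v(x;\tau)=\int_0^Te^{-\tau t}u_0(t,x)\,dt,\qquad I_\tau=\int_{\mathbb R^3}f(x)\,(w(x;\tau)-v(x;\tau))\,dx,$$ $$\tilde I_\tau=\int_0^T\!\!\int_{\mathbb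 R^3}e^{-\tau t}f(x)\,(u(t,x)-u_0(t,x))\,dx\,dt.$$ Then, for every $\tau\ge1$, $$\tilde I_\tau=\int_{\mathbb R^3}f(x)\,(w(x;\tau)-\tilde v(x;\tau))\,dx\qquad\text{and}\qquad |\tilde I_\tau-I_\tau|\le C\,\tau^{-1}e^{-\tau T}\,\|f\|_{L^2(\mathbb R^3)}^2 .$$ -/

import Mathlib

open MeasureTheory Set
open scoped Matrix ContDiff

noncomputable section

namespace WaveIndicator

/-- The Euclidean space `ℝ³`. -/
abbrev E3 : Type := EuclideanSpace ℝ (Fin 3)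

/-- Real-valued `L²(ℝ³)`. -/
abbrev L2 : Type := Lp ℝ 2 (volume : Measure E3)

/-- `L²(ℝ³; ℝ³)`, square integrable vector fields. -/
abbrev L2Vec : Type := Lp E3 2 (volume : Measure E3)

/-- The classical `i`-th partial derivative. -/
def pderiv (i : Fin 3) (φ : E3 → ℝ) (x : E3) : ℝ :=
  fderiv ℝ φ x (EuclideanSpace.single i (1 : ℝ))

/-- `g` is the weak (distributional) gradient of `u`, tested against `C_c^∞(ℝ³)`. -/
def HasWeakGradient (u : L2) (g : L2Vec) : Prop :=
  ∀ φ : E3 → ℝ, ContDiff ℝ ∞ φ → HasCompactSupport φ → ∀ i : Fin 3,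
    ∫ x, u x * pderiv i φ x = -∫ x, g x i * φ x

theorem memLp_pderiv {φ : E3 → ℝ} (hφ : ContDiff ℝ ∞ φ) (hc : HasCompactSupport φ)
    (i : Fin 3) : MemLp (pderiv i φ) 2 (volume : Measure E3) := by
  have h1 : Continuous (pderiv i φ) :=
    (hφ.continuous_fderiv (by simp)).clm_apply continuous_const
  exact h1.memLp_of_hasCompactSupport (hc.fderiv_apply (𝕜 := ℝ) _)

theorem integrable_mul_pderiv (u : L2) {φ : E3 → ℝ} (hφ : ContDiff ℝ ∞ φ)
    (hc : HasCompactSupport φ) (i : Fin 3) :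
    Integrable (fun x => u x * pderiv i φ x) (volume : Measure E3) :=
  (Lp.memLp u).integrable_mul (memLp_pderiv hφ hc i)

theorem integrable_coord_mul (g : L2Vec) {φ : E3 → ℝ} (hφ : ContDiff ℝ ∞ φ)
    (hc : HasCompactSupport φ) (i : Fin 3) :
    Integrable (fun x => g x i * φ x) (volume : Measure E3) := by
  have hg : MemLp (fun x => g x i) 2 (volume : Measure E3) :=
    (EuclideanSpace.proj (𝕜 := ℝ) i : E3 →L[ℝ] ℝ).comp_memLp' (Lp.memLp g)
  have hφ2 : MemLp φ 2 (volume : Measure E3) := hφ.continuous.memLp_of_hasCompactSupport hc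
  exact hg.integrable_mul hφ2

/-- The subspace of pairs `(u, ∇u)` of an `L²` function and its weak gradient in `L²`. -/
def H1Sub : Submodule ℝ (WithLp 2 (L2 × L2Vec)) where
  carrier := {p | HasWeakGradient p.fst p.snd}
  zero_mem' := by
    intro φ hφ hc i
    simp
  add_mem' := by
    intro p q hp hq φ hφ hc i
    have e1 : ∫ x, (p.fst + q.fst : L2) x * pderiv i φ x
        = (∫ x, p.fst x * pderiv i φ x) + ∫ x, q.fst x * pderiv i φ x := by
      rw [← integral_add (integrable_mul_pderiv _ hφ hc i) (integrable_mul_pderiv _ hφ hc i)]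
      refine integral_congr_ae ((Lp.coeFn_add p.fst q.fst).mono fun x hx => ?_)
      simp only [hx, Pi.add_apply, add_mul]
    have e2 : ∫ x, (p.snd + q.snd : L2Vec) x i * φ x
        = (∫ x, p.snd x i * φ x) + ∫ x, q.snd x i * φ x := by
      rw [← integral_add (integrable_coord_mul _ hφ hc i) (integrable_coord_mul _ hφ hc i)]
      refine integral_congr_ae ((Lp.coeFn_add p.snd q.snd).mono fun x hx => ?_)
      simp only [hx, Pi.add_apply, PiLp.add_apply, add_mul]
    rw [WithLp.add_fst, WithLp.add_snd, e1, e2, hp φ hφ hc i, hq φ hφ hc i]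
    ring
  smul_mem' := by
    intro c p hp φ hφ hc i
    have e1 : ∫ x, (c • p.fst : L2) x * pderiv i φ x = c * ∫ x, p.fst x * pderiv i φ x := by
      rw [← integral_const_mul]
      refine integral_congr_ae ((Lp.coeFn_smul c p.fst).mono fun x hx => ?_)
      simp only [hx, Pi.smul_apply, smul_eq_mul, mul_assoc]
    have e2 : ∫ x, (c • p.snd : L2Vec) x i * φ x = c * ∫ x, p.snd x i * φ x := by
      rw [← integral_const_mul]
      refine integral_congr_ae ((Lp.coeFn_smul c p.snd).mono fun x hx => ?_)
      simp only [hx, Pi.smul_apply, PiLp.smul_apply, smul_eq_mul, mul_assoc]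
    rw [WithLp.smul_fst, WithLp.smul_snd, e1, e2, hp φ hφ hc i]
    ring

/-- The Sobolev space `H¹(ℝ³)`, realized as the space of pairs `(u, ∇u)`, with the norm
`(‖u‖² + ‖∇u‖²)^{1/2}`. -/
def H1 : Type := H1Sub

instance : NormedAddCommGroup H1 := inferInstanceAs (NormedAddCommGroup H1Sub)

instance : InnerProductSpace ℝ H1 := inferInstanceAs (InnerProductSpace ℝ H1Sub)

theorem norm_fst_le (p : WithLp 2 (L2 × L2Vec)) : ‖p.fst‖ ≤ ‖p‖ := by
  rw [WithLp.prod_norm_eq_of_L2]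
  exact Real.le_sqrt_of_sq_le (le_add_of_nonneg_right (sq_nonneg _))

theorem norm_snd_le (p : WithLp 2 (L2 × L2Vec)) : ‖p.snd‖ ≤ ‖p‖ := by
  rw [WithLp.prod_norm_eq_of_L2]
  exact Real.le_sqrt_of_sq_le (le_add_of_nonneg_left (sq_nonneg _))

/-- The inclusion `H¹(ℝ³) → L²(ℝ³)`. -/
def toL2 : H1 →L[ℝ] L2 :=
  LinearMap.mkContinuous
    { toFun := fun p => p.1.fst
      map_add' := fun _ _ => rfl
      map_smul' := fun _ _ => rfl } 1
    (fun p => by rw [one_mul]; exact norm_fst_le p.1)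

/-- The weak gradient `H¹(ℝ³) → L²(ℝ³; ℝ³)`. -/
def grad : H1 →L[ℝ] L2Vec :=
  LinearMap.mkContinuous
    { toFun := fun p => p.1.snd
      map_add' := fun _ _ => rfl
      map_smul' := fun _ _ => rfl } 1
    (fun p => by rw [one_mul]; exact norm_snd_le p.1)

/-- The embedding `L²(ℝ³) → (H¹(ℝ³))'`, `g ↦ (φ ↦ ∫ g φ dx)`. -/
def toDual (g : L2) : StrongDual ℝ H1 := (innerSL ℝ g).comp toL2

/-- A matrix-valued coefficient on `ℝ³`. -/
abbrev Coeff : Type := E3 → Matrix (Fin 3) (Fin 3) ℝ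

/-- Symmetric, with entries in `L^∞(ℝ³)`, and uniformly positive definite almost everywhere. -/
structure IsAdmissible (γ : Coeff) : Prop where
  memLp_top : ∀ i j, MemLp (fun x => γ x i j) ⊤ (volume : Measure E3)
  symm : ∀ᵐ x ∂(volume : Measure E3), (γ x).IsSymm
  coercive : ∃ c₀ : ℝ, 0 < c₀ ∧ ∀ᵐ x ∂(volume : Measure E3), ∀ ξ : E3,
    c₀ * ‖ξ‖ ^ 2 ≤ (γ x *ᵥ ξ.ofLp) ⬝ᵥ ξ.ofLp

/-- The homogeneous medium `γ₀ = I₃`. -/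
def homogeneousMedium : Coeff := fun _ => 1

/-- The two-layered medium: `γp I₃` for `x₃ > 0` and `γm I₃` for `x₃ < 0`. (The value on the
null set `x₃ = 0` is immaterial.) -/
def layeredMedium (γp γm : ℝ) : Coeff := fun x => if 0 < x 2 then γp • 1 else γm • 1

/-- The background media: homogeneous, or two-layered with distinct positive constants. -/
def IsBackgroundMedium (γ₀ : Coeff) : Prop :=
  γ₀ = homogeneousMedium ∨
    ∃ γp γm : ℝ, 0 < γp ∧ 0 < γm ∧ γp ≠ γm ∧ γ₀ = layeredMedium γp γm

/-- The bilinear form `∫ γ ∇u · ∇φ dx` of `-L_γ = -div(γ ∇ ·)`. -/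
def form (γ : Coeff) (u φ : H1) : ℝ :=
  ∫ x, (γ x *ᵥ (grad u x).ofLp) ⬝ᵥ (grad φ x).ofLp

/-- `u'` is the weak (distributional) derivative of `u` on `(0, T)`, for functions with values in
a normed space. -/
def HasWeakTimeDeriv {X : Type} [NormedAddCommGroup X] [NormedSpace ℝ X] (T : ℝ)
    (u u' : ℝ → X) : Prop :=
  ∀ θ : ℝ → ℝ, ContDiff ℝ ∞ θ → HasCompactSupport θ → tsupport θ ⊆ Ioo 0 T →
    ∫ t in (0 : ℝ)..T, deriv θ t • u t = -∫ t in (0 : ℝ)..T, θ t • u' t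

/-- `u`, defined a.e. on `(0, T)`, has a continuous representative on `[0, T]` whose value at
time `0` is `a`. -/
def HasInitialValue {X : Type} [NormedAddCommGroup X] [NormedSpace ℝ X] (T : ℝ)
    (u : ℝ → X) (a : X) : Prop :=
  ∃ U : ℝ → X, ContinuousOn U (Icc 0 T) ∧ U =ᵐ[volume.restrict (Ioo 0 T)] u ∧ U 0 = a

/-- `u` is a weak solution of `(∂ₜ² - L_γ) u = 0` in `(0, T) × ℝ³`, `u(0) = 0`, `∂ₜ u(0) = f`:
`u ∈ L²(0,T;H¹)`, `∂ₜ u = u' ∈ L²(0,T;L²)`, `∂ₜ² u = u'' ∈ L²(0,T;(H¹)')`, the equation holds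
against every `φ ∈ H¹` for a.e. `t`, and the initial values are attained by the representatives
of `u` in `C([0,T];L²)` and of `∂ₜ u` in `C([0,T];(H¹)')`. -/
def IsWeakWaveSolution (γ : Coeff) (T : ℝ) (f : L2) (u : ℝ → H1) : Prop :=
  MemLp u 2 (volume.restrict (Ioo 0 T)) ∧
  ∃ (u' : ℝ → L2) (u'' : ℝ → StrongDual ℝ H1),
    MemLp u' 2 (volume.restrict (Ioo 0 T)) ∧
    MemLp u'' 2 (volume.restrict (Ioo 0 T)) ∧
    HasWeakTimeDeriv T (fun t => toL2 (u t)) u' ∧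
    HasWeakTimeDeriv T (fun t => toDual (u' t)) u'' ∧
    (∀ᵐ t ∂(volume.restrict (Ioo 0 T)), ∀ φ : H1, u'' t φ + form γ (u t) φ = 0) ∧
    HasInitialValue T (fun t => toL2 (u t)) 0 ∧
    HasInitialValue T (fun t => toDual (u' t)) (toDual f)

/-- `v ∈ H¹` is a weak solution of `(L_γ - τ²) v + f = 0` in `ℝ³`. -/
def IsResolventSolution (γ : Coeff) (τ : ℝ) (f : L2) (v : H1) : Prop :=
  ∀ φ : H1, form γ v φ + τ ^ 2 * ∫ x, toL2 v x * toL2 φ x = ∫ x, f x * toL2 φ x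

/-- The truncated Laplace transform `∫₀ᵀ e^{-τt} u(t) dt`, a Bochner integral in `L²(ℝ³)`. -/
def truncatedLaplace (T τ : ℝ) (u : ℝ → H1) : L2 :=
  ∫ t in (0 : ℝ)..T, Real.exp (-τ * t) • toL2 (u t)

/-- The indicator `I_τ = ∫ f (w - v) dx` with `w` the truncated Laplace transform of `u`. -/
def indicatorI (T τ : ℝ) (f : L2) (u : ℝ → H1) (v : H1) : ℝ :=
  ∫ x, f x * (truncatedLaplace T τ u x - toL2 v x)

/-- The alternative indicator
`Ĩ_τ = ∫₀ᵀ ∫ e^{-τt} f(x) (u(t,x) - u₀(t,x)) dx dt`. -/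
def indicatorAlt (T τ : ℝ) (f : L2) (u u₀ : ℝ → H1) : ℝ :=
  ∫ t in (0 : ℝ)..T, ∫ x, Real.exp (-τ * t) * f x * (toL2 (u t) x - toL2 (u₀ t) x)

end WaveIndicator

end

/-!
Integrate the background wave equation once in time. The state `(∫₀ᵗ u₀, ∫₀ᵗ ∂ₜu₀)` is absolutely
continuous in the energy norm, and the derivative of its energy is `2 ⟪f, u₀⟫`, so its energy at
time `T` is at most `(2T‖f‖)²`. Pairing the integrated equation with the resolvent solution `v`
makes the difference between `⟪f, v⟫` and the Laplace transform of `⟪f, u₀⟫` a pure boundary term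
at `t = T`: it is `e^{-τT}` times the energy pairing of `(v, -τv)` with the integrated state, minus
`⟪f, v⟫`. The energy of `(v, -τv)` is exactly `⟪f, v⟫ ≤ (‖f‖/τ)²`, and Cauchy–Schwarz concludes.
-/

noncomputable section

namespace WaveIndicator

section AbsolutelyContinuous

open Filter Topology

variable {X Y Z : Type*} {a b : ℝ}

theorem absolutelyContinuousOnInterval_of_dist_le [PseudoMetricSpace X] [PseudoMetricSpace Y]
    [PseudoMetricSpace Z] {F : ℝ → X} {G : ℝ → Y} {H : ℝ → Z} (C D : ℝ)
    (hF : AbsolutelyContinuousOnInterval F a b) (hG : AbsolutelyContinuousOnInterval G a b)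
    (hH : ∀ s ∈ uIcc a b, ∀ t ∈ uIcc a b,
      dist (H s) (H t) ≤ C * dist (F s) (F t) + D * dist (G s) (G t)) :
    AbsolutelyContinuousOnInterval H a b := by
  refine squeeze_zero' (.of_forall fun E => Finset.sum_nonneg fun i _ => dist_nonneg) ?_
    (by simpa using (Tendsto.const_mul C hF).add (Tendsto.const_mul D hG))
  filter_upwards [mem_inf_of_right (mem_principal_self _)] with E hE
  rw [Finset.mul_sum, Finset.mul_sum, ← Finset.sum_add_distrib]
  exact Finset.sum_le_sum fun i hi => hH _ (hE.1 i hi).1 _ (hE.1 i hi).2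

variable [NormedAddCommGroup X] [NormedSpace ℝ X] [NormedAddCommGroup Y] [NormedSpace ℝ Y]
  [NormedAddCommGroup Z] [NormedSpace ℝ Z]

theorem absolutelyContinuousOnInterval_bilinear (B : X →L[ℝ] Y →L[ℝ] Z) {F : ℝ → X} {G : ℝ → Y}
    (hF : AbsolutelyContinuousOnInterval F a b) (hG : AbsolutelyContinuousOnInterval G a b) :
    AbsolutelyContinuousOnInterval (fun t => B (F t) (G t)) a b := by
  obtain ⟨C, hC⟩ := hF.exists_bound
  obtain ⟨D, hD⟩ := hG.exists_bound
  refine absolutelyContinuousOnInterval_of_dist_le (‖B‖ * D) (‖B‖ * C) hF hG fun s hs t ht => ?_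
  simp only [dist_eq_norm]
  calc ‖B (F s) (G s) - B (F t) (G t)‖
      = ‖B (F s - F t) (G s) + B (F t) (G s - G t)‖ := by simp
    _ ≤ ‖B‖ * ‖F s - F t‖ * ‖G s‖ + ‖B‖ * ‖F t‖ * ‖G s - G t‖ :=
        norm_add_le_of_le (B.le_opNorm₂ _ _) (B.le_opNorm₂ _ _)
    _ ≤ ‖B‖ * ‖F s - F t‖ * D + ‖B‖ * C * ‖G s - G t‖ := by
        gcongr
        exacts [hD s hs, hC t ht]
    _ = ‖B‖ * D * ‖F s - F t‖ + ‖B‖ * C * ‖G s - G t‖ := by ring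

theorem absolutelyContinuousOnInterval_primitive {g : ℝ → X}
    (hg : IntervalIntegrable g volume a b) :
    AbsolutelyContinuousOnInterval (fun t => ∫ s in a..t, g s) a b := by
  have hnorm := hg.norm.absolutelyContinuousOnInterval_intervalIntegral left_mem_uIcc
  refine absolutelyContinuousOnInterval_of_dist_le 1 0 hnorm hnorm fun s hs t ht => ?_
  have hi : ∀ r ∈ uIcc a b, IntervalIntegrable g volume a r := fun r hr =>
    hg.mono_set (uIcc_subset_uIcc left_mem_uIcc hr)
  rw [dist_eq_norm, Real.dist_eq, one_mul, zero_mul, add_zero,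
    intervalIntegral.integral_interval_sub_left (hi s hs) (hi t ht),
    intervalIntegral.integral_interval_sub_left (hi s hs).norm (hi t ht).norm]
  exact intervalIntegral.norm_integral_le_abs_integral_norm

theorem integral_eq_sub_of_absolutelyContinuousOnInterval [CompleteSpace X] {F f : ℝ → X}
    (hF : AbsolutelyContinuousOnInterval F a b) (hf : IntervalIntegrable f volume a b)
    (hd : ∀ᵐ t, t ∈ uIcc a b → HasDerivAt F (f t) t) :
    ∫ t in a..b, f t = F b - F a := by
  have hG := hF.sub (absolutelyContinuousOnInterval_primitive hf)
  obtain ⟨C, hC⟩ := hG.const_of_ae_hasDerivAt_zero (by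
    filter_upwards [hd, hf.ae_hasDerivAt_integral] with t h1 h2 ht
    simpa using (h1 ht).sub (h2 ht a left_mem_uIcc))
  have ha : F a = C := by simpa using hC a left_mem_uIcc
  have hb : F b - ∫ t in a..b, f t = C := hC b right_mem_uIcc
  rw [ha, ← hb, sub_sub_cancel]

theorem integral_deriv_smul_primitive_add [CompleteSpace X] {g : ℝ → X}
    (hg : IntervalIntegrable g volume a b) {θ : ℝ → ℝ} (hθ : ContDiff ℝ 1 θ) :
    ∫ t in a..b, (θ t • g t + deriv θ t • ∫ s in a..t, g s) = θ b • ∫ t in a..b, g t := by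
  have hG := absolutelyContinuousOnInterval_primitive hg
  have hparts := integral_eq_sub_of_absolutelyContinuousOnInterval
    (hθ.contDiffOn.absolutelyContinuousOnInterval.smul hG)
    ((hg.continuousOn_smul hθ.continuous.continuousOn).add
      ((hθ.continuous_deriv le_rfl).continuousOn.smul hG.continuousOn).intervalIntegrable) (by
    filter_upwards [hg.ae_hasDerivAt_integral] with t ht htm
    exact (hθ.differentiable one_ne_zero t).hasDerivAt.smul (ht htm a left_mem_uIcc))
  simpa using hparts

theorem integral_exp_mul_sub_primitive {g : ℝ → ℝ} (hg : IntervalIntegrable g volume a b)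
    (τ : ℝ) :
    ∫ t in a..b, Real.exp (-τ * t) * (g t - τ * ∫ s in a..t, g s)
      = Real.exp (-τ * b) * ∫ t in a..b, g t := by
  have hderiv : deriv (fun t => Real.exp (-τ * t)) = fun t => Real.exp (-τ * t) * -τ :=
    funext fun t => by simpa using ((hasDerivAt_id t).const_mul (-τ)).exp.deriv
  rw [← smul_eq_mul, ← integral_deriv_smul_primitive_add hg
    (show ContDiff ℝ 1 fun t => Real.exp (-τ * t) by fun_prop), hderiv]
  refine intervalIntegral.integral_congr fun t _ => ?_
  simp only [smul_eq_mul]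
  ring

theorem mul_integral_exp_neg_mul (τ T : ℝ) :
    τ * ∫ t in (0 : ℝ)..T, Real.exp (-τ * t) = 1 - Real.exp (-τ * T) := by
  have hd : ∀ t, HasDerivAt (fun t => -Real.exp (-τ * t)) (τ * Real.exp (-τ * t)) t := fun t => by
    convert! ((hasDerivAt_id t).const_mul (-τ)).exp.neg using 1
    simp [mul_comm]
  rw [← intervalIntegral.integral_const_mul,
    intervalIntegral.integral_eq_sub_of_hasDerivAt (fun t _ => hd t)
      (Continuous.intervalIntegrable (by fun_prop) _ _)]
  simp [neg_add_eq_sub]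

theorem bilinear_primitive_self_eq_integral [CompleteSpace X] {B : X →L[ℝ] X →L[ℝ] ℝ}
    (hB : ∀ x y, B x y = B y x) {g : ℝ → X} (hg : IntervalIntegrable g volume a b) {p : ℝ → ℝ}
    (hp : IntervalIntegrable p volume a b)
    (hBp : ∀ᵐ t, t ∈ uIcc a b → B (∫ s in a..t, g s) (g t) = p t) :
    B (∫ t in a..b, g t) (∫ t in a..b, g t) = ∫ t in a..b, 2 * p t := by
  have hG := absolutelyContinuousOnInterval_primitive hg
  rw [integral_eq_sub_of_absolutelyContinuousOnInterval
    (absolutelyContinuousOnInterval_bilinear B hG hG) (hp.const_mul 2)]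
  · simp
  filter_upwards [hg.ae_hasDerivAt_integral, hBp] with t hgt hpt htm
  have hd := hgt htm a left_mem_uIcc
  convert! B.hasDerivAt_of_bilinear (fun _ => hd) (fun _ => hd) using 1
  rw [hB (g t), hpt htm, two_mul]

theorem intervalIntegrable_clm_comp (L : X →L[ℝ] Y) {g : ℝ → X}
    (hg : IntervalIntegrable g volume a b) :
    IntervalIntegrable (fun t => L (g t)) volume a b :=
  ⟨L.integrable_comp hg.1, L.integrable_comp hg.2⟩

end AbsolutelyContinuous

section WeakDerivative

open Function

variable {X : Type*} [NormedAddCommGroup X] [NormedSpace ℝ X]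

theorem support_primitive_subset_Icc {ψ : ℝ → X} {c d : ℝ} (hψ : support ψ ⊆ Ioo c d)
    (hi : ∫ t, ψ t = 0) : support (fun t => ∫ s in c..t, ψ s) ⊆ Icc c d := by
  refine support_subset_iff'.2 fun t ht => ?_
  rcases lt_or_ge t c with htc | hct
  · refine intervalIntegral.integral_zero_ae (.of_forall fun s hs => notMem_support.1 fun hψs => ?_)
    rw [uIoc_of_ge htc.le] at hs
    exact (hψ hψs).1.not_ge hs.2
  · have hdt : d < t := not_le.1 fun htd => ht ⟨hct, htd⟩
    rw [intervalIntegral.integral_eq_integral_of_support_subset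
      (hψ.trans fun s hs => ⟨hs.1, (hs.2.trans hdt).le⟩), hi]

theorem exists_contDiff_deriv_eq_of_integral_eq_zero [CompleteSpace X] {s : Set ℝ}
    (hs : s.OrdConnected) {ψ : ℝ → X} (hψ : ContDiff ℝ ∞ ψ) (hc : HasCompactSupport ψ)
    (hψs : tsupport ψ ⊆ s) (hi : ∫ t, ψ t = 0) :
    ∃ θ : ℝ → X, ContDiff ℝ ∞ θ ∧ HasCompactSupport θ ∧ tsupport θ ⊆ s ∧ deriv θ = ψ := by
  rcases (tsupport ψ).eq_empty_or_nonempty with hempty | hne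
  · refine ⟨0, contDiff_const, .zero, by simp, ?_⟩
    rw [tsupport_eq_empty_iff.1 hempty]
    exact deriv_const' 0
  obtain ⟨c, hcψ, hc_le⟩ := hc.isCompact.exists_isLeast hne
  obtain ⟨d, hdψ, hle_d⟩ := hc.isCompact.exists_isGreatest hne
  have hIoo : support ψ ⊆ Ioo c d := interior_Icc (a := c) ▸
    hψ.continuous.isOpen_support.subset_interior_iff.2 fun t ht =>
      ⟨hc_le (subset_tsupport ψ ht), hle_d (subset_tsupport ψ ht)⟩
  have hsupp := support_primitive_subset_Icc hIoo hi
  have hderiv : deriv (fun t => ∫ s in c..t, ψ s) = ψ :=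
    funext fun t => hψ.continuous.deriv_integral ψ c t
  refine ⟨fun t => ∫ s in c..t, ψ s, contDiff_infty_iff_deriv.2 ⟨fun t => ?_, hderiv.symm ▸ hψ⟩,
    .of_support_subset_isCompact isCompact_Icc hsupp,
    (closure_minimal hsupp isClosed_Icc).trans (hs.out (hψs hcψ) (hψs hdψ)), hderiv⟩
  exact (hψ.continuous.integral_hasStrictDerivAt c t).hasDerivAt.differentiableAt

theorem exists_contDiff_integral_eq_one {E : Type*} [NormedAddCommGroup E] [NormedSpace ℝ E]
    [HasContDiffBump E] [MeasurableSpace E] [BorelSpace E] [FiniteDimensional ℝ E]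
    (μ : Measure E) [IsLocallyFiniteMeasure μ] [μ.IsOpenPosMeasure] {s : Set E} {x : E}
    (hs : s ∈ nhds x) :
    ∃ ψ : E → ℝ, ContDiff ℝ ∞ ψ ∧ HasCompactSupport ψ ∧ tsupport ψ ⊆ s ∧ ∫ y, ψ y ∂μ = 1 := by
  obtain ⟨r, hr, hrs⟩ := Metric.nhds_basis_closedBall.mem_iff.1 hs
  let ψ : ContDiffBump x := ⟨r / 2, r, half_pos hr, half_lt_self hr⟩
  exact ⟨ψ.normed μ, ψ.contDiff_normed, ψ.hasCompactSupport_normed, by rwa [ψ.tsupport_normed_eq],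
    ψ.integral_normed⟩

theorem integrable_smul_of_tsupport_subset {s : Set ℝ} {z : ℝ → X}
    (hz : LocallyIntegrableOn z s) {ψ : ℝ → ℝ} (hψ : Continuous ψ) (hc : HasCompactSupport ψ)
    (hψs : tsupport ψ ⊆ s) : Integrable (fun t => ψ t • z t) :=
  (integrableOn_iff_integrable_of_support_subset
    ((support_smul_subset_left ψ z).trans (subset_tsupport ψ))).1
    ((hz.integrableOn_compact_subset hψs hc).continuousOn_smul hψ.continuousOn hc)

variable {s : Set ℝ} {z : ℝ → X}

theorem integral_smul_eq_of_integral_deriv_smul_eq_zero (hs : s.OrdConnected)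
    (hz : LocallyIntegrableOn z s)
    (h : ∀ θ : ℝ → ℝ, ContDiff ℝ ∞ θ → HasCompactSupport θ → tsupport θ ⊆ s →
      ∫ t, deriv θ t • z t = 0)
    {ρ ψ : ℝ → ℝ} (hρ : ContDiff ℝ ∞ ρ) (hρc : HasCompactSupport ρ) (hρs : tsupport ρ ⊆ s)
    (hρ1 : ∫ t, ρ t = 1) (hψ : ContDiff ℝ ∞ ψ) (hψc : HasCompactSupport ψ)
    (hψs : tsupport ψ ⊆ s) :
    ∫ t, ψ t • z t = (∫ t, ψ t) • ∫ t, ρ t • z t := by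
  have hψi : Integrable ψ := hψ.continuous.integrable_of_hasCompactSupport hψc
  have hρi : Integrable ρ := hρ.continuous.integrable_of_hasCompactSupport hρc
  have hψz := integrable_smul_of_tsupport_subset hz hψ.continuous hψc hψs
  -- `ψ - (∫ ψ) ρ` has mean zero, so it is the derivative of a test function.
  generalize hm : ∫ t, ψ t = m
  have hηs : tsupport (ψ - m • ρ) ⊆ s :=
    (tsupport_sub ψ _).trans
      (union_subset hψs ((tsupport_smul_subset_right (fun _ => m) ρ).trans hρs))
  have hηi : ∫ t, (ψ - m • ρ) t = 0 := by
    simp only [Pi.sub_apply, Pi.smul_apply, smul_eq_mul]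
    rw [integral_sub hψi (hρi.const_mul m), integral_const_mul, hρ1, hm, mul_one, sub_self]
  have hηc : HasCompactSupport (ψ - m • ρ) := hψc.sub (.smul_left (f := fun _ => m) hρc)
  obtain ⟨θ, hθ, hθc, hθs, hθψ⟩ := exists_contDiff_deriv_eq_of_integral_eq_zero hs
    (hψ.sub (hρ.const_smul m)) hηc hηs hηi
  have hmρz : Integrable (fun t => m • ρ t • z t) :=
    (integrable_smul_of_tsupport_subset hz hρ.continuous hρc hρs).smul m
  rw [← sub_eq_zero, ← integral_smul, ← integral_sub hψz hmρz, ← h θ hθ hθc hθs, hθψ]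
  simp only [sub_smul, smul_assoc]

theorem ae_eq_const_of_integral_deriv_smul_eq_zero [CompleteSpace X] (hs : IsOpen s)
    (hconn : s.OrdConnected) (hz : LocallyIntegrableOn z s)
    (h : ∀ θ : ℝ → ℝ, ContDiff ℝ ∞ θ → HasCompactSupport θ → tsupport θ ⊆ s →
      ∫ t, deriv θ t • z t = 0) :
    ∃ c : X, ∀ᵐ t, t ∈ s → z t = c := by
  rcases s.eq_empty_or_nonempty with rfl | ⟨t₀, ht₀⟩
  · exact ⟨0, by simp⟩
  obtain ⟨ρ, hρ, hρc, hρs, hρ1⟩ := exists_contDiff_integral_eq_one volume (hs.mem_nhds ht₀)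
  have hzc := hz.sub ((locallyIntegrable_const (∫ t, ρ t • z t)).locallyIntegrableOn s)
  refine ⟨∫ t, ρ t • z t, (hs.ae_eq_zero_of_integral_contDiff_smul_eq_zero hzc
    fun ψ hψ hψc hψs => ?_).mono fun t ht hts => sub_eq_zero.1 (ht hts)⟩
  have hψi : Integrable ψ := hψ.continuous.integrable_of_hasCompactSupport hψc
  have hψz := integrable_smul_of_tsupport_subset hz hψ.continuous hψc hψs
  simp only [Pi.sub_apply, smul_sub]
  rw [integral_sub hψz (hψi.smul_const _), integral_smul_const,
    integral_smul_eq_of_integral_deriv_smul_eq_zero hconn hz h hρ hρc hρs hρ1 hψ hψc hψs, sub_self]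

end WeakDerivative

section WeakTimeDerivative

variable {X : Type} [NormedAddCommGroup X] [NormedSpace ℝ X]

theorem HasWeakTimeDeriv.congr_ae {T : ℝ} (hT : 0 ≤ T) {w₁ w₂ w' : ℝ → X}
    (h : HasWeakTimeDeriv T w₁ w') (hw : w₁ =ᵐ[volume.restrict (Ioo 0 T)] w₂) :
    HasWeakTimeDeriv T w₂ w' := fun θ hθ hc hθT => by
  rw [← h θ hθ hc hθT]
  refine intervalIntegral.integral_congr_ae_restrict ?_
  rw [uIoc_of_le hT, ← restrict_Ioo_eq_restrict_Ioc]
  filter_upwards [hw] with t ht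
  rw [ht]

variable [CompleteSpace X]

theorem HasWeakTimeDeriv.integral_deriv_smul_sub_primitive_eq_zero {T : ℝ} (hT : 0 ≤ T)
    {w w' : ℝ → X} (h : HasWeakTimeDeriv T w w') (hw : ContinuousOn w (Icc 0 T))
    (hw' : IntervalIntegrable w' volume 0 T) {θ : ℝ → ℝ} (hθ : ContDiff ℝ ∞ θ)
    (hc : HasCompactSupport θ) (hθT : tsupport θ ⊆ Ioo 0 T) :
    ∫ t, deriv θ t • (w t - ∫ s in (0 : ℝ)..t, w' s) = 0 := by
  have hθ1 : ContDiff ℝ 1 θ := hθ.of_le (by simp)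
  have hθ' : ContinuousOn (deriv θ) (uIcc 0 T) := (hθ1.continuous_deriv le_rfl).continuousOn
  have hθG : IntervalIntegrable (fun t => deriv θ t • ∫ s in (0 : ℝ)..t, w' s) volume 0 T :=
    (hθ'.smul (absolutelyContinuousOnInterval_primitive hw').continuousOn).intervalIntegrable
  have hparts := integral_deriv_smul_primitive_add hw' hθ1
  rw [image_eq_zero_of_notMem_tsupport fun hmem => (hθT hmem).2.false, zero_smul,
    intervalIntegral.integral_add (hw'.continuousOn_smul hθ.continuous.continuousOn)
      hθG] at hparts
  have hθw : IntervalIntegrable (fun t => deriv θ t • w t) volume 0 T :=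
    (hθ'.smul (uIcc_of_le hT ▸ hw)).intervalIntegrable
  have hsupp : Function.support (fun t => deriv θ t • (w t - ∫ s in (0 : ℝ)..t, w' s)) ⊆ Ioc 0 T :=
    (Function.support_smul_subset_left _ _).trans
      (support_deriv_subset.trans (hθT.trans Ioo_subset_Ioc_self))
  rw [← intervalIntegral.integral_eq_integral_of_support_subset hsupp]
  simp only [smul_sub]
  rw [intervalIntegral.integral_sub hθw hθG, h θ hθ hc hθT, ← neg_add', hparts, neg_zero]

theorem HasWeakTimeDeriv.eqOn_add_primitive {T : ℝ} (hT : 0 < T) {w w' : ℝ → X}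
    (h : HasWeakTimeDeriv T w w') (hw : ContinuousOn w (Icc 0 T))
    (hw' : IntervalIntegrable w' volume 0 T) :
    EqOn w (fun t => w 0 + ∫ s in (0 : ℝ)..t, w' s) (Icc 0 T) := by
  have hW : ContinuousOn (fun t => w t - ∫ s in (0 : ℝ)..t, w' s) (Icc 0 T) :=
    hw.sub (uIcc_of_le hT.le ▸ (absolutelyContinuousOnInterval_primitive hw').continuousOn)
  obtain ⟨c, hc⟩ := ae_eq_const_of_integral_deriv_smul_eq_zero isOpen_Ioo ordConnected_Ioo
    ((hW.mono Ioo_subset_Icc_self).locallyIntegrableOn measurableSet_Ioo)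
    fun θ hθ hθc hθT => h.integral_deriv_smul_sub_primitive_eq_zero hT.le hw hw' hθ hθc hθT
  have hconst : EqOn (fun t => w t - ∫ s in (0 : ℝ)..t, w' s) (fun _ => c) (Icc 0 T) :=
    (Measure.eqOn_open_of_ae_eq ((ae_restrict_iff' measurableSet_Ioo).2 hc) isOpen_Ioo
      (hW.mono Ioo_subset_Icc_self) continuousOn_const).of_subset_closure hW continuousOn_const
      Ioo_subset_Icc_self (closure_Ioo hT.ne).ge
  intro t ht
  have h0 : w 0 = c := by simpa using hconst (left_mem_Icc.2 hT.le)
  exact eq_add_of_sub_eq ((hconst ht).trans h0.symm)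

theorem HasWeakTimeDeriv.ae_eq_add_primitive {T : ℝ} (hT : 0 < T) {w w' : ℝ → X} {a : X}
    (h : HasWeakTimeDeriv T w w') (hw' : IntervalIntegrable w' volume 0 T)
    (ha : HasInitialValue T w a) :
    ∀ᵐ t ∂(volume.restrict (Ioo 0 T)), w t = a + ∫ s in (0 : ℝ)..t, w' s := by
  obtain ⟨W, hW, hWw, rfl⟩ := ha
  have hprim := (h.congr_ae hT.le hWw.symm).eqOn_add_primitive hT hW hw'
  filter_upwards [hWw, ae_restrict_mem measurableSet_Ioo] with t ht htT
  rw [← ht, hprim (Ioo_subset_Icc_self htT)]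

end WeakTimeDerivative

section IntegratedWave

variable {X H : Type*} [NormedAddCommGroup X] [NormedSpace ℝ X]
  [NormedAddCommGroup H] [InnerProductSpace ℝ H]

/-- The energy inner product `B x y + ⟪h, k⟫` of the states `(x, h)` and `(y, k)`, where `B` is the
potential energy form. -/
def energyForm (B : X →L[ℝ] X →L[ℝ] ℝ) : (X × H) →L[ℝ] (X × H) →L[ℝ] ℝ :=
  B.bilinearComp (.fst ℝ X H) (.fst ℝ X H)
    + isBoundedBilinearMap_inner.toContinuousLinearMap.bilinearComp (.snd ℝ X H) (.snd ℝ X H)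

theorem energyForm_apply (B : X →L[ℝ] X →L[ℝ] ℝ) (p q : X × H) :
    energyForm B p q = B p.1 q.1 + inner ℝ p.2 q.2 := rfl

theorem energyForm_comm {B : X →L[ℝ] X →L[ℝ] ℝ} (hB : ∀ x y, B x y = B y x) (p q : X × H) :
    energyForm B p q = energyForm B q p := by
  rw [energyForm_apply, energyForm_apply, hB, real_inner_comm]

theorem norm_snd_sq_le_energyForm {B : X →L[ℝ] X →L[ℝ] ℝ} (hB : ∀ x, 0 ≤ B x x) (p : X × H) :
    ‖p.2‖ ^ 2 ≤ energyForm B p p := by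
  rw [energyForm_apply, real_inner_self_eq_norm_sq]
  exact le_add_of_nonneg_left (hB p.1)

theorem energyForm_nonneg {B : X →L[ℝ] X →L[ℝ] ℝ} (hB : ∀ x, 0 ≤ B x x) (p : X × H) :
    0 ≤ energyForm B p p :=
  (sq_nonneg _).trans (norm_snd_sq_le_energyForm hB p)

theorem energyForm_sq_le {B : X →L[ℝ] X →L[ℝ] ℝ} (hsymm : ∀ x y, B x y = B y x)
    (hnonneg : ∀ x, 0 ≤ B x x) (p q : X × H) :
    energyForm B p q ^ 2 ≤ energyForm B p p * energyForm B q q :=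
  LinearMap.BilinForm.apply_sq_le_of_symm (energyForm B).toBilinForm
    (energyForm_nonneg hnonneg) ⟨energyForm_comm hsymm⟩ p q

variable {ι : X →L[ℝ] H} {B : X →L[ℝ] X →L[ℝ] ℝ} {f : H} {τ : ℝ} {v : X}

theorem energyForm_resolvent_self
    (hv : ∀ φ, B v φ + τ ^ 2 * inner ℝ (ι v) (ι φ) = inner ℝ f (ι φ)) :
    energyForm B (v, -(τ • ι v)) (v, -(τ • ι v)) = inner ℝ f (ι v) := by
  rw [← hv v, energyForm_apply, inner_neg_neg, real_inner_smul_left, real_inner_smul_right]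
  ring

theorem energyForm_resolvent_le (hnonneg : ∀ x, 0 ≤ B x x) (hτ : 0 < τ)
    (hv : ∀ φ, B v φ + τ ^ 2 * inner ℝ (ι v) (ι φ) = inner ℝ f (ι φ)) :
    energyForm B (v, -(τ • ι v)) (v, -(τ • ι v)) ≤ (τ⁻¹ * ‖f‖) ^ 2 := by
  set E := energyForm B (v, -(τ • ι v)) (v, -(τ • ι v)) with hE
  have hkinetic : (τ * ‖ι v‖) ^ 2 ≤ E := by
    simpa [norm_smul, abs_of_pos hτ] using norm_snd_sq_le_energyForm hnonneg (v, -(τ • ι v))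
  have hpairing : E ≤ τ⁻¹ * ‖f‖ * (τ * ‖ι v‖) := by
    rw [hE, energyForm_resolvent_self hv, mul_mul_mul_comm, inv_mul_cancel₀ hτ.ne', one_mul]
    exact real_inner_le_norm f (ι v)
  linarith [two_mul_le_add_sq (τ⁻¹ * ‖f‖) (τ * ‖ι v‖)]

theorem integral_inner_le_of_norm_sq_le {y : ℝ → H} {T : ℝ} (hT : 0 ≤ T)
    (hy : ContinuousOn y (Icc 0 T))
    (h : ∀ t ∈ Icc 0 T, ‖y t‖ ^ 2 ≤ ∫ s in (0 : ℝ)..t, 2 * inner ℝ f (y s)) :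
    ∫ t in (0 : ℝ)..T, 2 * inner ℝ f (y t) ≤ (2 * T * ‖f‖) ^ 2 := by
  obtain ⟨m, hm, hmax⟩ := isCompact_Icc.exists_isMaxOn (nonempty_Icc.2 hT) hy.norm
  have hint : ∀ t ∈ Icc 0 T, ∫ s in (0 : ℝ)..t, 2 * inner ℝ f (y s) ≤ 2 * T * ‖f‖ * ‖y m‖ := by
    intro t ht
    calc ∫ s in (0 : ℝ)..t, 2 * inner ℝ f (y s)
        ≤ 2 * (‖f‖ * ‖y m‖) * |t - 0| := by
          refine (Real.le_norm_self _).trans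
            (intervalIntegral.norm_integral_le_of_norm_le_const fun s hs => ?_)
          rw [uIoc_of_le ht.1] at hs
          rw [norm_mul, Real.norm_two]
          gcongr
          exact (norm_inner_le_norm _ _).trans
            (by gcongr; exact hmax ⟨hs.1.le, hs.2.trans ht.2⟩)
      _ ≤ 2 * (‖f‖ * ‖y m‖) * T := by
          rw [sub_zero, abs_of_nonneg ht.1]
          gcongr
          exact ht.2
      _ = 2 * T * ‖f‖ * ‖y m‖ := by ring
  have hym : ‖y m‖ ≤ 2 * T * ‖f‖ := by
    have hsq := (h m hm).trans (hint m hm)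
    by_contra! hlt
    have h0 : 0 ≤ 2 * T * ‖f‖ := by positivity
    nlinarith
  calc ∫ t in (0 : ℝ)..T, 2 * inner ℝ f (y t)
      ≤ 2 * T * ‖f‖ * ‖y m‖ := hint T (right_mem_Icc.2 hT)
    _ ≤ (2 * T * ‖f‖) ^ 2 := by rw [sq]; gcongr

/-- The weak form of the abstract wave equation `∂ₜ² u + B u = 0`, `u(0) = 0`, `∂ₜ u(0) = f`,
integrated once in time. The trajectory `z = (u, ∂ₜ u)` lives in phase space, `ι` is the embedding
of the form domain, and both equations hold for almost every time between `0` and `T`. -/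
structure IsIntegratedWave (ι : X →L[ℝ] H) (B : X →L[ℝ] X →L[ℝ] ℝ) (T : ℝ) (f : H)
    (z : ℝ → X × H) : Prop where
  intervalIntegrable : IntervalIntegrable z volume 0 T
  displacement : ∀ᵐ t, t ∈ uIcc 0 T → ι (z t).1 = (∫ s in (0 : ℝ)..t, z s).2
  velocity : ∀ᵐ t, t ∈ uIcc 0 T → ∀ φ,
    inner ℝ (z t).2 (ι φ) + B (∫ s in (0 : ℝ)..t, z s).1 φ = inner ℝ f (ι φ)

variable {T : ℝ} {z : ℝ → X × H}

theorem IsIntegratedWave.mono (h : IsIntegratedWave ι B T f z) {t : ℝ} (ht : t ∈ uIcc 0 T) :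
    IsIntegratedWave ι B t f z := by
  have hsub : uIcc 0 t ⊆ uIcc 0 T := uIcc_subset_uIcc left_mem_uIcc ht
  exact ⟨h.intervalIntegrable.mono_set hsub,
    h.displacement.mono fun s hs hst => hs (hsub hst),
    h.velocity.mono fun s hs hst => hs (hsub hst)⟩

theorem IsIntegratedWave.continuousOn_displacement (h : IsIntegratedWave ι B T f z) :
    ContinuousOn (fun t => (∫ s in (0 : ℝ)..t, z s).2) (uIcc 0 T) :=
  continuous_snd.comp_continuousOn
    (absolutelyContinuousOnInterval_primitive h.intervalIntegrable).continuousOn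

/-- The two equations combine so that the boundary term of the Laplace transform of `u` is the
energy pairing with the state `(v, -τ v)`, the data at time `0` of the wave `e^{-τt} v`. -/
theorem IsIntegratedWave.energyForm_resolvent_sub (h : IsIntegratedWave ι B T f z)
    (hB : ∀ x y, B x y = B y x)
    (hv : ∀ φ, B v φ + τ ^ 2 * inner ℝ (ι v) (ι φ) = inner ℝ f (ι φ)) :
    ∀ᵐ t, t ∈ uIcc 0 T →
      energyForm B (v, -(τ • ι v)) (z t) - τ * energyForm B (v, -(τ • ι v)) (∫ s in (0 : ℝ)..t, z s)
        = inner ℝ f (ι (z t).1) - τ * inner ℝ f (ι v) := by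
  filter_upwards [h.displacement, h.velocity] with t hdisp hvel ht
  have hvel := hvel ht v
  rw [real_inner_comm, hB] at hvel
  simp only [energyForm_apply, ← hdisp ht, ← hv (z t).1, ← hvel, inner_neg_left,
    real_inner_smul_left]
  ring

variable [CompleteSpace X] [CompleteSpace H]

theorem IsIntegratedWave.energyForm_eq_integral (h : IsIntegratedWave ι B T f z)
    (hB : ∀ x y, B x y = B y x) :
    energyForm B (∫ t in (0 : ℝ)..T, z t) (∫ t in (0 : ℝ)..T, z t)
      = ∫ t in (0 : ℝ)..T, 2 * inner ℝ f (∫ s in (0 : ℝ)..t, z s).2 := by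
  refine bilinear_primitive_self_eq_integral (energyForm_comm hB) h.intervalIntegrable
    (continuousOn_const.inner h.continuousOn_displacement).intervalIntegrable ?_
  filter_upwards [h.displacement, h.velocity] with t hdisp hvel ht
  rw [energyForm_apply, ← hdisp ht, ← hvel ht, real_inner_comm, add_comm]

theorem IsIntegratedWave.energyForm_le (h : IsIntegratedWave ι B T f z) (hT : 0 ≤ T)
    (hsymm : ∀ x y, B x y = B y x) (hnonneg : ∀ x, 0 ≤ B x x) :
    energyForm B (∫ t in (0 : ℝ)..T, z t) (∫ t in (0 : ℝ)..T, z t) ≤ (2 * T * ‖f‖) ^ 2 := by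
  have hcont := h.continuousOn_displacement
  rw [h.energyForm_eq_integral hsymm]
  rw [uIcc_of_le hT] at hcont
  refine integral_inner_le_of_norm_sq_le hT hcont fun t ht => ?_
  rw [← uIcc_of_le hT] at ht
  rw [← (h.mono ht).energyForm_eq_integral hsymm]
  exact norm_snd_sq_le_energyForm hnonneg _

theorem IsIntegratedWave.laplace_sub_resolvent (h : IsIntegratedWave ι B T f z)
    (hB : ∀ x y, B x y = B y x)
    (hv : ∀ φ, B v φ + τ ^ 2 * inner ℝ (ι v) (ι φ) = inner ℝ f (ι φ)) :
    (∫ t in (0 : ℝ)..T, Real.exp (-τ * t) * inner ℝ f (ι (z t).1)) - inner ℝ f (ι v)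
      = Real.exp (-τ * T)
        * (energyForm B (v, -(τ • ι v)) (∫ t in (0 : ℝ)..T, z t) - inner ℝ f (ι v)) := by
  set ℓ := energyForm B (v, -(τ • ι v))
  have hz := h.intervalIntegrable
  have hℓ : ∀ t ∈ uIcc 0 T, ∫ s in (0 : ℝ)..t, ℓ (z s) = ℓ (∫ s in (0 : ℝ)..t, z s) :=
    fun t ht => ℓ.intervalIntegral_comp_comm (hz.mono_set (uIcc_subset_uIcc left_mem_uIcc ht))
  have hboundary := integral_exp_mul_sub_primitive (intervalIntegrable_clm_comp ℓ hz) τ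
  have hcongr : ∫ t in (0 : ℝ)..T, Real.exp (-τ * t) * (ℓ (z t) - τ * ∫ s in (0 : ℝ)..t, ℓ (z s))
      = ∫ t in (0 : ℝ)..T, (Real.exp (-τ * t) * inner ℝ f (ι (z t).1)
        - τ * inner ℝ f (ι v) * Real.exp (-τ * t)) := by
    refine intervalIntegral.integral_congr_ae
      ((h.energyForm_resolvent_sub hB hv).mono fun t hℓt ht => ?_)
    rw [hℓ t (uIoc_subset_uIcc ht), hℓt (uIoc_subset_uIcc ht)]
    ring
  rw [hcongr, intervalIntegral.integral_sub, intervalIntegral.integral_const_mul,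
    hℓ T right_mem_uIcc] at hboundary
  · linear_combination hboundary + inner ℝ f (ι v) * mul_integral_exp_neg_mul τ T
  · exact (intervalIntegrable_clm_comp ((innerSL ℝ f).comp (ι.comp (.fst ℝ X H)))
      hz).continuousOn_mul (by fun_prop)
  · exact Continuous.intervalIntegrable (by fun_prop) _ _

theorem IsIntegratedWave.abs_laplace_sub_resolvent_le (h : IsIntegratedWave ι B T f z)
    (hT : 0 ≤ T) (hsymm : ∀ x y, B x y = B y x) (hnonneg : ∀ x, 0 ≤ B x x) (hτ : 0 < τ)
    (hv : ∀ φ, B v φ + τ ^ 2 * inner ℝ (ι v) (ι φ) = inner ℝ f (ι φ)) :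
    |(∫ t in (0 : ℝ)..T, Real.exp (-τ * t) * inner ℝ f (ι (z t).1)) - inner ℝ f (ι v)|
      ≤ (2 * T + τ⁻¹) * τ⁻¹ * Real.exp (-τ * T) * ‖f‖ ^ 2 := by
  set p := (v, -(τ • ι v))
  set Z := ∫ t in (0 : ℝ)..T, z t
  have hp : energyForm B p p ≤ (τ⁻¹ * ‖f‖) ^ 2 := energyForm_resolvent_le hnonneg hτ hv
  have hpZ : |energyForm B p Z| ≤ τ⁻¹ * ‖f‖ * (2 * T * ‖f‖) := by
    refine abs_le_of_sq_le_sq ?_ (by positivity)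
    rw [mul_pow]
    exact (energyForm_sq_le hsymm hnonneg p Z).trans (mul_le_mul hp
      (h.energyForm_le hT hsymm hnonneg) (energyForm_nonneg hnonneg Z) (by positivity))
  rw [h.laplace_sub_resolvent hsymm hv, abs_mul, Real.abs_exp, ← energyForm_resolvent_self hv]
  calc Real.exp (-τ * T) * |energyForm B p Z - energyForm B p p|
      ≤ Real.exp (-τ * T) * (τ⁻¹ * ‖f‖ * (2 * T * ‖f‖) + (τ⁻¹ * ‖f‖) ^ 2) := by
        gcongr
        exact (abs_sub _ _).trans
          (add_le_add hpZ ((abs_of_nonneg (energyForm_nonneg hnonneg p)).trans_le hp))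
    _ = (2 * T + τ⁻¹) * τ⁻¹ * Real.exp (-τ * T) * ‖f‖ ^ 2 := by ring

end IntegratedWave

section Coefficient

variable {α : Type*} [MeasurableSpace α] {μ : Measure α}

theorem inner_eq_integral_mul (f g : Lp ℝ 2 μ) : inner ℝ f g = ∫ x, f x * g x ∂μ := by
  rw [L2.inner_def]
  exact integral_congr_ae (.of_forall fun x => mul_comm _ _)

theorem integral_mul_sub_eq_inner (f g h : Lp ℝ 2 μ) :
    ∫ x, f x * (g x - h x) ∂μ = inner ℝ f (g - h) := by
  rw [inner_eq_integral_mul]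
  refine integral_congr_ae ((Lp.coeFn_sub g h).mono fun x hx => ?_)
  simp only [hx, Pi.sub_apply]

variable {n : Type*} [Fintype n] {γ : α → Matrix n n ℝ}

theorem memLp_sum_smul {F : Type*} [NormedAddCommGroup F] [NormedSpace ℝ F] {p : ENNReal}
    (hγ : ∀ i j, MemLp (fun x => γ x i j) p μ) (b : n → n → F) :
    MemLp (fun x => ∑ i, ∑ j, γ x i j • b i j) p μ :=
  memLp_finsetSum _ fun i _ => memLp_finsetSum _ fun j _ =>
    (ContinuousLinearMap.toSpanSingleton ℝ (b i j)).comp_memLp' (hγ i j)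

variable [DecidableEq n]

theorem memLp_toEuclideanCLM {p : ENNReal} (hγ : ∀ i j, MemLp (fun x => γ x i j) p μ) :
    MemLp (fun x => Matrix.toEuclideanCLM (𝕜 := ℝ) (γ x)) p μ := by
  have hsum : (fun x => Matrix.toEuclideanCLM (𝕜 := ℝ) (γ x)) = fun x => ∑ i, ∑ j,
      γ x i j • Matrix.toEuclideanCLM (𝕜 := ℝ) (Matrix.single i j 1) := by
    funext x
    conv_lhs => rw [Matrix.matrix_eq_sum_single (γ x)]
    simp [← map_smul]
  rw [hsum]
  exact memLp_sum_smul hγ _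

/-- Multiplication of square integrable vector fields by a matrix-valued function with bounded
entries. -/
def mulCoeff (hγ : ∀ i j, MemLp (fun x => γ x i j) ⊤ μ) :
    Lp (EuclideanSpace ℝ n) 2 μ →L[ℝ] Lp (EuclideanSpace ℝ n) 2 μ :=
  ContinuousLinearMap.holderL μ ⊤ 2 2 (.id ℝ _) ((memLp_toEuclideanCLM hγ).toLp _)

theorem coeFn_mulCoeff (hγ : ∀ i j, MemLp (fun x => γ x i j) ⊤ μ)
    (g : Lp (EuclideanSpace ℝ n) 2 μ) :
    mulCoeff hγ g =ᵐ[μ] fun x => Matrix.toEuclideanCLM (𝕜 := ℝ) (γ x) (g x) := by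
  filter_upwards [ContinuousLinearMap.coeFn_holder (r := 2)
    (.id ℝ (EuclideanSpace ℝ n →L[ℝ] EuclideanSpace ℝ n)) ((memLp_toEuclideanCLM hγ).toLp _) g,
    (memLp_toEuclideanCLM hγ).coeFn_toLp] with x hx hγx
  rw [← hγx]
  exact hx

end Coefficient

section Form

theorem isClosed_H1Sub : IsClosed (H1Sub : Set (WithLp 2 (L2 × L2Vec))) := by
  have hset : (H1Sub : Set (WithLp 2 (L2 × L2Vec))) =
      ⋂ (φ : E3 → ℝ) (_ : ContDiff ℝ ∞ φ) (_ : HasCompactSupport φ) (i : Fin 3),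
        {p | ∫ x, p.fst x * pderiv i φ x = -∫ x, p.snd x i * φ x} := by
    ext p
    simp only [mem_iInter]
    rfl
  rw [hset]
  refine isClosed_iInter fun φ => isClosed_iInter fun hφ => isClosed_iInter fun hc =>
    isClosed_iInter fun i => ?_
  have hpderiv := memLp_pderiv hφ hc i
  have hsingle : MemLp (fun x => EuclideanSpace.single i (φ x)) 2 (volume : Measure E3) :=
    Continuous.memLp_of_hasCompactSupport
      ((PiLp.continuous_toLp 2 _).comp ((continuous_single i).comp hφ.continuous))
      (hc.comp_left (g := EuclideanSpace.single i) (by simp))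
  have hfst (p : WithLp 2 (L2 × L2Vec)) :
      ∫ x, p.fst x * pderiv i φ x = inner ℝ p.fst (hpderiv.toLp _) := by
    rw [inner_eq_integral_mul]
    refine integral_congr_ae (hpderiv.coeFn_toLp.mono fun x hx => ?_)
    simp only [hx]
  have hsnd (p : WithLp 2 (L2 × L2Vec)) :
      ∫ x, p.snd x i * φ x = inner ℝ p.snd (hsingle.toLp _) := by
    rw [L2.inner_def]
    refine integral_congr_ae (hsingle.coeFn_toLp.mono fun x hx => ?_)
    simp only [hx, EuclideanSpace.inner_single_right, conj_trivial, mul_comm]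
  simp only [hfst, hsnd]
  exact isClosed_eq (by fun_prop) (by fun_prop)

instance : CompleteSpace H1 :=
  (isClosed_H1Sub.isComplete.completeSpace_coe : CompleteSpace H1Sub)

variable {γ : Coeff}

/-- The form `form γ` of a coefficient with bounded entries, as a bounded bilinear form on
`H¹(ℝ³)`. -/
def formCLM (hγ : ∀ i j, MemLp (fun x => γ x i j) ⊤ (volume : Measure E3)) :
    H1 →L[ℝ] H1 →L[ℝ] ℝ :=
  isBoundedBilinearMap_inner.toContinuousLinearMap.bilinearComp ((mulCoeff hγ).comp grad) grad

theorem formCLM_apply (hγ : ∀ i j, MemLp (fun x => γ x i j) ⊤ (volume : Measure E3))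
    (u φ : H1) : formCLM hγ u φ = form γ u φ := by
  change inner ℝ (mulCoeff hγ (grad u)) (grad φ) = form γ u φ
  rw [L2.inner_def, form]
  refine integral_congr_ae ((coeFn_mulCoeff hγ (grad u)).mono fun x hx => ?_)
  simp only [hx, EuclideanSpace.inner_eq_star_dotProduct, Matrix.ofLp_toEuclideanCLM,
    star_trivial]
  exact dotProduct_comm _ _

theorem form_comm (hγ : ∀ᵐ x, (γ x).IsSymm) (u φ : H1) : form γ u φ = form γ φ u := by
  refine integral_congr_ae (hγ.mono fun x hx => ?_)
  simp only
  rw [dotProduct_comm, Matrix.dotProduct_mulVec, ← Matrix.mulVec_transpose, hx.eq]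

theorem form_self_nonneg (hγ : ∀ᵐ x, (γ x).PosSemidef) (u : H1) : 0 ≤ form γ u u := by
  refine integral_nonneg_of_ae (hγ.mono fun x hx => ?_)
  change 0 ≤ (γ x *ᵥ (grad u x).ofLp) ⬝ᵥ (grad u x).ofLp
  rw [dotProduct_comm]
  exact hx.dotProduct_mulVec_nonneg (grad u x).ofLp

theorem IsBackgroundMedium.memLp_top (hγ : IsBackgroundMedium γ) (i j : Fin 3) :
    MemLp (fun x => γ x i j) ⊤ (volume : Measure E3) := by
  rcases hγ with rfl | ⟨γp, γm, -, -, -, rfl⟩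
  · exact memLp_top_const _
  · have hs : MeasurableSet {x : E3 | 0 < x 2} :=
      measurableSet_lt measurable_const (by fun_prop)
    have hlayers := MemLp.piecewise (μ := volume) hs
      ((memLp_top_const ((γp • 1 : Matrix (Fin 3) (Fin 3) ℝ) i j)).restrict _)
      ((memLp_top_const ((γm • 1 : Matrix (Fin 3) (Fin 3) ℝ) i j)).restrict _)
    convert! hlayers using 1
    funext x
    simp only [layeredMedium, Set.piecewise, mem_ofPred_eq]
    split_ifs <;> rfl

theorem IsBackgroundMedium.posSemidef (hγ : IsBackgroundMedium γ) (x : E3) :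
    (γ x).PosSemidef := by
  rcases hγ with rfl | ⟨γp, γm, hp, hm, -, rfl⟩
  · exact .one
  · rw [layeredMedium]
    split_ifs
    exacts [.smul .one hp.le, .smul .one hm.le]

end Form

section Indicator

variable {T : ℝ}

theorem intervalIntegrable_of_memLp {X : Type*} [NormedAddCommGroup X] {p : ENNReal}
    (hp : 1 ≤ p) (hT : 0 ≤ T) {w : ℝ → X} (hw : MemLp w p (volume.restrict (Ioo 0 T))) :
    IntervalIntegrable w volume 0 T :=
  (intervalIntegrable_iff_integrableOn_Ioo_of_le hT).2 (hw.integrable hp)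

theorem ae_imp_of_ae_restrict_Ioo (hT : 0 ≤ T) {p : ℝ → Prop}
    (h : ∀ᵐ t ∂(volume.restrict (Ioo 0 T)), p t) : ∀ᵐ t, t ∈ uIcc 0 T → p t := by
  rwa [← ae_restrict_iff' measurableSet_uIcc, uIcc_of_le hT, ← restrict_Ioo_eq_restrict_Icc]

variable {γ : Coeff} {f : L2} {u u₀ : ℝ → H1}

theorem integral_eq_neg_formCLM (hγ : ∀ i j, MemLp (fun x => γ x i j) ⊤ (volume : Measure E3))
    (hu : IntervalIntegrable u volume 0 T) {u'' : ℝ → StrongDual ℝ H1}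
    (h : ∀ᵐ t, t ∈ uIcc 0 T → ∀ φ, u'' t φ + form γ (u t) φ = 0) {t : ℝ} (ht : t ∈ uIcc 0 T) :
    ∫ s in (0 : ℝ)..t, u'' s = -formCLM hγ (∫ s in (0 : ℝ)..t, u s) := by
  have hsub : uIcc 0 t ⊆ uIcc 0 T := uIcc_subset_uIcc left_mem_uIcc ht
  rw [← (formCLM hγ).intervalIntegral_comp_comm (hu.mono_set hsub),
    ← intervalIntegral.integral_neg]
  refine intervalIntegral.integral_congr_ae (h.mono fun s hs hst => ?_)
  ext φ
  rw [neg_apply, formCLM_apply]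
  exact eq_neg_of_add_eq_zero_left (hs (hsub (uIoc_subset_uIcc hst)) φ)

theorem IsWeakWaveSolution.exists_isIntegratedWave
    (hγ : ∀ i j, MemLp (fun x => γ x i j) ⊤ (volume : Measure E3)) (hT : 0 < T)
    (h : IsWeakWaveSolution γ T f u) :
    ∃ u' : ℝ → L2, IsIntegratedWave toL2 (formCLM hγ) T f fun t => (u t, u' t) := by
  obtain ⟨hu, u', u'', hu', hu'', hderiv, hderiv', heq, hinit, hinit'⟩ := h
  replace hu := intervalIntegrable_of_memLp one_le_two hT.le hu
  replace hu' := intervalIntegrable_of_memLp one_le_two hT.le hu'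
  replace hu'' := intervalIntegrable_of_memLp one_le_two hT.le hu''
  have hz : IntervalIntegrable (fun t => (u t, u' t)) volume 0 T :=
    ⟨hu.1.prodMk hu'.1, hu.2.prodMk hu'.2⟩
  have hprim {t : ℝ} (ht : t ∈ uIcc 0 T) :
      ∫ s in (0 : ℝ)..t, (u s, u' s) = (∫ s in (0 : ℝ)..t, u s, ∫ s in (0 : ℝ)..t, u' s) := by
    have hzt := hz.mono_set (uIcc_subset_uIcc left_mem_uIcc ht)
    exact Prod.ext ((ContinuousLinearMap.fst ℝ H1 L2).intervalIntegral_comp_comm hzt).symm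
      ((ContinuousLinearMap.snd ℝ H1 L2).intervalIntegral_comp_comm hzt).symm
  refine ⟨u', hz, ?_, ?_⟩
  · filter_upwards [ae_imp_of_ae_restrict_Ioo hT.le (hderiv.ae_eq_add_primitive hT hu' hinit)]
      with t hut ht
    rw [hprim ht, hut ht, zero_add]
  · filter_upwards [ae_imp_of_ae_restrict_Ioo hT.le
      (hderiv'.ae_eq_add_primitive hT hu'' hinit')] with t hut ht φ
    have hut := congrArg (fun ℓ : StrongDual ℝ H1 => ℓ φ) (hut ht)
    rw [integral_eq_neg_formCLM hγ hu (ae_imp_of_ae_restrict_Ioo hT.le heq) ht] at hut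
    rw [hprim ht]
    exact eq_add_neg_iff_add_eq.1 hut

variable {τ : ℝ}

theorem inner_truncatedLaplace (hu : IntervalIntegrable u volume 0 T) :
    inner ℝ f (truncatedLaplace T τ u)
      = ∫ t in (0 : ℝ)..T, Real.exp (-τ * t) * inner ℝ f (toL2 (u t)) := by
  simpa only [truncatedLaplace, innerSL_apply_apply, real_inner_smul_right] using
    ((innerSL ℝ f).intervalIntegral_comp_comm
      ((intervalIntegrable_clm_comp toL2 hu).continuousOn_smul
        (f := fun t => Real.exp (-τ * t)) (by fun_prop))).symm

theorem indicatorAlt_eq_inner (hu : IntervalIntegrable u volume 0 T)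
    (hu₀ : IntervalIntegrable u₀ volume 0 T) :
    indicatorAlt T τ f u u₀
      = inner ℝ f (truncatedLaplace T τ u - truncatedLaplace T τ u₀) := by
  have hint {w : ℝ → H1} (hw : IntervalIntegrable w volume 0 T) :
      IntervalIntegrable (fun t => Real.exp (-τ * t) * inner ℝ f (toL2 (w t))) volume 0 T :=
    (intervalIntegrable_clm_comp ((innerSL ℝ f).comp toL2) hw).continuousOn_mul (by fun_prop)
  rw [inner_sub_right, inner_truncatedLaplace hu, inner_truncatedLaplace hu₀,
    ← intervalIntegral.integral_sub (hint hu) (hint hu₀)]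
  refine intervalIntegral.integral_congr fun t _ => ?_
  simp only [mul_assoc]
  rw [integral_const_mul, integral_mul_sub_eq_inner, inner_sub_right, mul_sub]

end Indicator

end WaveIndicator


end

open WaveIndicator in
theorem mainTheorem5_general {T : ℝ} (hT : 0 < T) {γ₀ : Coeff}
    (hbdd : ∀ i j, MemLp (fun x => γ₀ x i j) ⊤ (volume : Measure E3))
    (hpos : ∀ᵐ x, (γ₀ x).PosSemidef) {f : L2} {u u₀ : ℝ → H1}
    (hu : IntervalIntegrable u volume 0 T) (hu₀ : IsWeakWaveSolution γ₀ T f u₀) {τ : ℝ}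
    (hτ : 0 < τ) {v : H1} (hv : IsResolventSolution γ₀ τ f v) :
    indicatorAlt T τ f u u₀ =
        ∫ x, f x * (truncatedLaplace T τ u x - truncatedLaplace T τ u₀ x) ∧
      |indicatorAlt T τ f u u₀ - indicatorI T τ f u v|
        ≤ (2 * T + τ⁻¹) * τ⁻¹ * Real.exp (-τ * T) * ‖f‖ ^ 2 := by
  have hint₀ : IntervalIntegrable u₀ volume 0 T :=
    intervalIntegrable_of_memLp one_le_two hT.le hu₀.1
  rw [integral_mul_sub_eq_inner, indicatorAlt_eq_inner hu hint₀]
  refine ⟨rfl, ?_⟩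
  obtain ⟨u₀', hwave⟩ := hu₀.exists_isIntegratedWave hbdd hT
  have hsymm (x y : H1) : formCLM hbdd x y = formCLM hbdd y x := by
    rw [formCLM_apply, formCLM_apply, form_comm]
    exact hpos.mono fun x hx => (Matrix.conjTranspose_eq_transpose_of_trivial _).symm.trans hx.1
  have hnonneg (x : H1) : 0 ≤ formCLM hbdd x x :=
    (form_self_nonneg hpos x).trans_eq (formCLM_apply hbdd x x).symm
  have hresolvent (φ : H1) : formCLM hbdd v φ + τ ^ 2 * inner ℝ (toL2 v) (toL2 φ)
      = inner ℝ f (toL2 φ) := by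
    rw [formCLM_apply, inner_eq_integral_mul, inner_eq_integral_mul, hv φ]
  rw [indicatorI, integral_mul_sub_eq_inner, ← inner_sub_right, sub_sub_sub_cancel_left,
    inner_sub_right, abs_sub_comm, inner_truncatedLaplace hint₀]
  exact hwave.abs_laplace_sub_resolvent_le hT.le hsymm hnonneg hτ hresolvent

theorem mainTheorem5 (T : ℝ) (hT : 0 < T)
    (γ₀ : WaveIndicator.Coeff) (hγ₀ : WaveIndicator.IsBackgroundMedium γ₀) :
    ∃ C : ℝ, 0 < C ∧
      ∀ γ : WaveIndicator.Coeff, WaveIndicator.IsAdmissible γ →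
      ∀ (f : WaveIndicator.L2) (u u₀ : ℝ → WaveIndicator.H1),
        WaveIndicator.IsWeakWaveSolution γ T f u →
        WaveIndicator.IsWeakWaveSolution γ₀ T f u₀ →
      ∀ (τ : ℝ), 1 ≤ τ → ∀ v : WaveIndicator.H1,
        WaveIndicator.IsResolventSolution γ₀ τ f v →
        WaveIndicator.indicatorAlt T τ f u u₀ =
            ∫ x, f x * (WaveIndicator.truncatedLaplace T τ u x
              - WaveIndicator.truncatedLaplace T τ u₀ x) ∧
        |WaveIndicator.indicatorAlt T τ f u u₀ - WaveIndicator.indicatorI T τ f u v|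
          ≤ C * τ⁻¹ * Real.exp (-τ * T) * ‖f‖ ^ 2 := by
  refine ⟨2 * T + 1, by positivity, fun γ _ f u u₀ hu hu₀ τ hτ v hv => ?_⟩
  have hτ₀ : 0 < τ := one_pos.trans_le hτ
  obtain ⟨heq, hle⟩ := mainTheorem5_general hT hγ₀.memLp_top (.of_forall hγ₀.posSemidef)
    (WaveIndicator.intervalIntegrable_of_memLp one_le_two hT.le hu.1) hu₀ hτ₀ hv
  refine ⟨heq, hle.trans ?_⟩
  gcongr
  exact inv_le_one_of_one_le₀ hτ
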